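/- Let $G$ be a finite solvable group. (1) Let $p$ be a prime and let $\sigma \in \operatorname{Gal}(\mathbb{Q}_{|G|}/\mathbb{Q})$ be an element of order $p$, where $\mathbb{Q}_{n}$ denotes the subfield of $\mathbb{C}$ generated by the complex $n$-th roots of unity. The group $\operatorname{Gal}(\mathbb{Q}_{|G|}/\mathbb{Q})$ acts on the complex irreducible characters of $G$ through their values, $\chi^{\sigma}(g)=\sigma(\chi(g))$ (character values of $G$ lie in $\mathbb{Q}_{|G|}$), and $\chi$ is called $\sigma$-invariant if $\chi^\sigma=\chi$. Suppose that $p$ does not divide the degree $\chi(1)$ of any $\sigma$-invariant irreducible character $\chi$ of $G$. Then $G$ has a normal Sylow $p$-subgroup. (2) In particular (for $|G|>2$ this is the case of (1) in which $p=2$ and $\sigma$ is complex conjugation), if $2$ does not divide the degree of any real-valued irreducible character of $G$, then $G$ has a normal Sylow $2$-subgroup. -/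

import Mathlib

/-- The `n`-th cyclotomic field `ℚ_n`, realized as the subfield of `ℂ` generated over `ℚ` by the
complex `n`-th roots of unity. -/
noncomputable def cyclotomicSubfield (n : ℕ) : IntermediateField ℚ ℂ :=
  IntermediateField.adjoin ℚ {z : ℂ | z ^ n = 1}

/-- `Irr(G)`: the set of characters of the irreducible finite-dimensional complex representations
of `G`. -/
def Irr (G : Type*) [Group G] : Set (G → ℂ) :=
  {χ | ∃ (n : ℕ) (ρ : Representation ℂ G (Fin n → ℂ)), ρ.IsIrreducible ∧ ρ.character = χ}

theorem Irr.exists_eval_one {G : Type*} [Group G] (χ : Irr G) : ∃ d : ℕ, χ.1 1 = d := by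
  obtain ⟨χ, n, ρ, -, rfl⟩ := χ
  exact ⟨n, by simp⟩

/-- The degree `χ(1)` of an irreducible character, as a natural number. -/
noncomputable def Irr.degree {G : Type*} [Group G] (χ : Irr G) : ℕ :=
  Classical.choose (Irr.exists_eval_one χ)

theorem Irr.eval_one {G : Type*} [Group G] (χ : Irr G) : χ.1 1 = Irr.degree χ :=
  Classical.choose_spec (Irr.exists_eval_one χ)

/-- The values of the characters of a finite group `G` lie in `ℚ_{|G|}`. -/
theorem Irr.mem_cyclotomicSubfield {G : Type*} [Group G] [Finite G] (χ : Irr G) (g : G) :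
    χ.1 g ∈ cyclotomicSubfield (Nat.card G) := by
  obtain ⟨χ, n, ρ, -, rfl⟩ := χ
  change LinearMap.trace ℂ _ (ρ g) ∈ _
  rw [Module.End.trace_eq_sum_roots_charpoly_of_splits (IsAlgClosed.splits _)]
  refine multiset_sum_mem _ fun z hz => IntermediateField.subset_adjoin _ _ ?_
  have hz' : Module.End.HasEigenvalue (ρ g) z :=
    (Module.End.hasEigenvalue_iff_isRoot_charpoly (ρ g) z).2 (Polynomial.isRoot_of_mem_roots hz)
  obtain ⟨v, hv⟩ := hz'.exists_hasEigenvector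
  have h := hv.pow_apply (Nat.card G)
  rw [← map_pow, pow_card_eq_one', map_one] at h
  have h' : (z ^ Nat.card G - 1) • v = 0 := by
    rw [sub_smul, ← h, one_smul]; simp
  exact sub_eq_zero.1 ((smul_eq_zero.1 h').resolve_right hv.2)

/-- The Galois conjugate `χ^σ`, `g ↦ σ (χ g)`, of an irreducible character `χ` of the finite
group `G` by an element `σ` of `Gal(ℚ_{|G|} / ℚ)`. -/
noncomputable def Irr.galConj {G : Type*} [Group G] [Finite G] (χ : Irr G)
    (σ : cyclotomicSubfield (Nat.card G) ≃ₐ[ℚ] cyclotomicSubfield (Nat.card G)) : G → ℂ :=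
  fun g => (σ ⟨χ.1 g, Irr.mem_cyclotomicSubfield χ g⟩ : ℂ)

/-!
The field automorphism `σ` is extended to a ring automorphism `τ` of `ℂ`, and the theorem is proved
for every `τ` such that `τ ^ p` fixes the `|G|`-th roots of unity
(`Sylow.exists_normal_of_galois_fixed_not_dvd`). Unlike "`σ` has order `p`", this condition passes to
quotients of `G`, and it covers complex conjugation with no assumption on `|G|`.

The proof is by induction on `|G|`. Let `N ≠ 1` be a normal abelian subgroup of prime exponent `q`,
and let `P` be a Sylow `p`-subgroup. By induction `G ⧸ N` has a normal Sylow `p`-subgroup, so `NP` is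
normal in `G`. If `q = p` then `NP` is itself the Sylow subgroup. If `q ≠ p` and `P` centralizes
`N`, then `P` is normal by the Frattini argument. The remaining case, `q ≠ p` and `P` not
centralizing `N`, contradicts the hypothesis, in three steps.

* Some linear character `μ` of `N` is moved by `P`, while `τ ∘ μ` is a `G`-conjugate of `μ`
  (`exists_linearCharacter_galois_conj`). Indeed `τ` acts on the characters of `N` as multiplication
  by some `s ∈ 𝔽_q` with `s ^ p = 1`. If `s = 1`, any `μ` moved by `P` will do. Otherwise, an element
  of `P` inducing an automorphism of order `p` of the dual of `N` has an eigenvalue which is a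
  primitive `p`-th root of unity, and a power of it has the eigenvalue `s`.
* If `μ` is a weight of an irreducible representation `V` of `G`, then `p ∣ dim V`
  (`Representation.dvd_finrank_of_weight_ne`): the vectors fixed by `[N, NP]` form a proper
  subrepresentation, hence `0`, so no weight of `V` is fixed by `P`, and `P` permutes the weight
  spaces.
* There is a `τ`-invariant irreducible character with weight `μ`
  (`Irr.exists_galois_fixed_dvd_degree`). As `N ∩ P = 1`, the multiplicity of `μ` in the permutation
  module on `G ⧸ P` is `|G : P| / |N|`, which is prime to `p`. The permutation character is rational
  and `μ ^ τ` is conjugate to `μ`, so both the multiplicity of an irreducible character `χ` in it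
  and the multiplicity of `μ` in `χ` are constant on the orbits of `τ`. These have length `1` or `p`,
  so orbits of length `1` must contribute.
-/

open Representation
open scoped commutatorElement

/-! ### Irreducible characters: transport, Galois action, decomposition -/

theorem Representation.isIrreducible_iff_submodule {G V : Type*} [Group G] [AddCommGroup V]
    [Module ℂ V] (ρ : Representation ℂ G V) :
    ρ.IsIrreducible ↔ Nontrivial V ∧
      ∀ W : Submodule ℂ V, (∀ g, ∀ v ∈ W, ρ g v ∈ W) → W = ⊥ ∨ W = ⊤ := by
  constructor
  · intro h
    refine ⟨?_, fun W hW => ?_⟩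
    · by_contra hV
      rw [not_nontrivial_iff_subsingleton] at hV
      exact bot_ne_top (α := Subrepresentation ρ)
        (Subrepresentation.toSubmodule_injective (Subsingleton.elim _ _))
    · exact (h.eq_bot_or_eq_top ⟨W, hW⟩).imp (congrArg Subrepresentation.toSubmodule)
        (congrArg Subrepresentation.toSubmodule)
  · rintro ⟨hV, h⟩
    refine { exists_pair_ne := ⟨⊥, ⊤, fun hbt => ?_⟩, eq_bot_or_eq_top := fun W => ?_ }
    · exact bot_ne_top (α := Submodule ℂ V) (congrArg Subrepresentation.toSubmodule hbt)
    · exact (h W.toSubmodule W.apply_mem_toSubmodule).imp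
        (fun h => Subrepresentation.toSubmodule_injective h)
        (fun h => Subrepresentation.toSubmodule_injective h)

/-- `Irr G` is defined by representations on `Fin n → ℂ`; a choice of basis shows that it contains the
character of every irreducible finite-dimensional representation. -/
theorem Representation.character_mem_irr {G V : Type*} [Group G] [AddCommGroup V] [Module ℂ V]
    [FiniteDimensional ℂ V] (ρ : Representation ℂ G V) (hρ : ρ.IsIrreducible) :
    ρ.character ∈ Irr G := by
  let e := (Module.finBasis ℂ V).equivFun
  let ρ' : Representation ℂ G (Fin (Module.finrank ℂ V) → ℂ) :=
    { toFun := fun g => e.conj (ρ g)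
      map_one' := by rw [map_one]; exact e.conj_id
      map_mul' := fun g h => by
        ext v; simp [LinearEquiv.conj_apply] }
  have hρ' : ∀ g v, ρ' g v = e (ρ g (e.symm v)) := fun g v => rfl
  refine ⟨_, ρ', ?_, ?_⟩
  · rw [isIrreducible_iff_submodule] at hρ ⊢
    obtain ⟨hV, h⟩ := hρ
    refine ⟨e.symm.toEquiv.nontrivial, fun W hW => ?_⟩
    have := h (W.comap e.toLinearMap) fun g v hv => by
      simpa [hρ'] using hW g (e v) hv
    refine this.imp (fun h => ?_) (fun h => ?_)
    · have h2 := congrArg (Submodule.map e.toLinearMap) h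
      rwa [Submodule.map_comap_eq_of_surjective e.surjective, Submodule.map_bot] at h2
    · have h2 := congrArg (Submodule.map e.toLinearMap) h
      rwa [Submodule.map_comap_eq_of_surjective e.surjective, Submodule.map_top,
        LinearMap.range_eq_top.2 e.surjective] at h2
  · ext g
    exact LinearMap.trace_conj' (ρ g) e

theorem Irr.degree_eq {G : Type*} [Group G] (χ : Irr G) {d : ℕ} (h : χ.1 1 = d) :
    Irr.degree χ = d := by
  rw [Irr.eval_one] at h
  exact_mod_cast h

/-- Inflation of irreducible characters along a surjective homomorphism. -/
theorem Irr.comp_mem {G H : Type*} [Group G] [Group H] (f : G →* H)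
    (hf : Function.Surjective f) (χ : Irr H) : χ.1 ∘ f ∈ Irr G := by
  obtain ⟨χ, n, ρ, hρ, rfl⟩ := χ
  refine ⟨n, ρ.comp f, ?_, rfl⟩
  rw [isIrreducible_iff_submodule] at hρ ⊢
  refine ⟨hρ.1, fun W hW => hρ.2 W fun h v hv => ?_⟩
  obtain ⟨g, rfl⟩ := hf h
  exact hW g v hv

/-- The representation whose matrices are obtained from those of `ρ` by applying `τ` to the entries,
written as the conjugate of `ρ g` by the semilinear bijection `v ↦ τ ∘ v`. -/
def Representation.galoisTwist {G : Type*} [Group G] {n : ℕ} (τ : ℂ ≃+* ℂ)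
    (ρ : Representation ℂ G (Fin n → ℂ)) : Representation ℂ G (Fin n → ℂ) where
  toFun g :=
    { toFun := fun v => τ ∘ ρ g (τ.symm ∘ v)
      map_add' := fun v w => by
        have : (τ.symm ∘ (v + w) : Fin n → ℂ) = τ.symm ∘ v + τ.symm ∘ w := by ext; simp
        ext; simp [this]
      map_smul' := fun c v => by
        have : (τ.symm ∘ (c • v) : Fin n → ℂ) = τ.symm c • τ.symm ∘ v := by ext; simp
        ext; simp [this] }
  map_one' := by ext; simp
  map_mul' g h := by
    refine LinearMap.ext fun v => ?_
    have : ∀ w : Fin n → ℂ, (τ.symm ∘ (τ ∘ w) : Fin n → ℂ) = w := fun w => by ext; simp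
    simp [this]

theorem Representation.galoisTwist_apply {G : Type*} [Group G] {n : ℕ} (τ : ℂ ≃+* ℂ)
    (ρ : Representation ℂ G (Fin n → ℂ)) (g : G) (v : Fin n → ℂ) :
    ρ.galoisTwist τ g v = τ ∘ ρ g (τ.symm ∘ v) := rfl

theorem Representation.character_galoisTwist {G : Type*} [Group G] {n : ℕ} (τ : ℂ ≃+* ℂ)
    (ρ : Representation ℂ G (Fin n → ℂ)) :
    (ρ.galoisTwist τ).character = τ ∘ ρ.character := by
  ext g
  have key : ∀ i : Fin n, (τ.symm ∘ (Pi.single i 1 : Fin n → ℂ)) = Pi.single i 1 := fun i => by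
    ext j
    by_cases hj : j = i
    · subst hj; simp
    · simp [hj]
  simp only [character, Function.comp_apply]
  rw [LinearMap.trace_eq_matrix_trace ℂ (Pi.basisFun ℂ (Fin n)),
    LinearMap.trace_eq_matrix_trace ℂ (Pi.basisFun ℂ (Fin n)), Matrix.trace, Matrix.trace, map_sum]
  refine Finset.sum_congr rfl fun i _ => ?_
  simp [galoisTwist_apply, key]

theorem Irr.comp_ringEquiv_mem {G : Type*} [Group G] (τ : ℂ ≃+* ℂ) (χ : Irr G) :
    τ ∘ χ.1 ∈ Irr G := by
  obtain ⟨χ, n, ρ, hρ, rfl⟩ := χ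
  refine ⟨n, ρ.galoisTwist τ, ?_, character_galoisTwist τ ρ⟩
  rw [isIrreducible_iff_submodule] at hρ ⊢
  have h1 : ∀ w : Fin n → ℂ, (τ.symm ∘ (τ ∘ w) : Fin n → ℂ) = w := fun w => by ext; simp
  have h2 : ∀ w : Fin n → ℂ, (τ ∘ (τ.symm ∘ w) : Fin n → ℂ) = w := fun w => by ext; simp
  refine ⟨hρ.1, fun W hW => ?_⟩
  let U : Submodule ℂ (Fin n → ℂ) :=
    { carrier := {v | τ ∘ v ∈ W}
      add_mem' := fun {v w} hv hw => by
        have : (τ ∘ (v + w) : Fin n → ℂ) = τ ∘ v + τ ∘ w := by ext; simp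
        simpa only [Set.mem_ofPred_eq, this] using W.add_mem hv hw
      zero_mem' := by
        have : (τ ∘ (0 : Fin n → ℂ) : Fin n → ℂ) = 0 := by ext; simp
        simp only [Set.mem_ofPred_eq, this, W.zero_mem]
      smul_mem' := fun c v hv => by
        have : (τ ∘ (c • v) : Fin n → ℂ) = τ c • (τ ∘ v) := by ext; simp
        simpa only [Set.mem_ofPred_eq, this] using W.smul_mem (τ c) hv }
  have hU : ∀ v, v ∈ U ↔ τ ∘ v ∈ W := fun v => Iff.rfl
  refine (hρ.2 U fun g v hv => ?_).imp (fun h => ?_) (fun h => ?_)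
  · have := hW g _ ((hU v).1 hv)
    rwa [galoisTwist_apply, h1] at this
  · refine (Submodule.eq_bot_iff _).2 fun w hw => ?_
    have : τ.symm ∘ w ∈ U := by rwa [hU, h2]
    rw [h, Submodule.mem_bot] at this
    rw [← h2 w, this]
    ext; simp
  · refine Submodule.eq_top_iff'.2 fun w => ?_
    have : τ.symm ∘ w ∈ U := h ▸ Submodule.mem_top
    rwa [hU, h2] at this

/-- The permutation `χ ↦ χ ^ τ` of the irreducible characters induced by an automorphism of `ℂ`. -/
noncomputable def Irr.galoisPerm {G : Type*} [Group G] (τ : ℂ ≃+* ℂ) : Equiv.Perm (Irr G) where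
  toFun χ := ⟨τ ∘ χ.1, Irr.comp_ringEquiv_mem τ χ⟩
  invFun χ := ⟨τ.symm ∘ χ.1, Irr.comp_ringEquiv_mem τ.symm χ⟩
  left_inv χ := Subtype.ext (by ext; simp)
  right_inv χ := Subtype.ext (by ext; simp)

theorem Irr.galoisPerm_apply {G : Type*} [Group G] (τ : ℂ ≃+* ℂ) (χ : Irr G) :
    (Irr.galoisPerm τ χ).1 = τ ∘ χ.1 := rfl

/-- A consequence of the orthogonality relations. -/
theorem Irr.linearIndependent (G : Type*) [Group G] [Finite G] :
    LinearIndependent ℂ (fun χ : Irr G => χ.1) := by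
  classical
  have := Fintype.ofFinite G
  have : Invertible (Nat.card G : ℂ) := invertibleOfNonzero (by exact_mod_cast Nat.card_pos.ne')
  have key : ∀ χ ψ : Irr G,
      (Nat.card G : ℂ)⁻¹ * ∑ g : G, χ.1 g * ψ.1 g⁻¹ = if χ = ψ then 1 else 0 := by
    rintro ⟨_, n, ρ, hρ, rfl⟩ ⟨_, m, ρ', hρ', rfl⟩
    split_ifs with h
    · have h : ρ.character = ρ'.character := congrArg Subtype.val h
      simp only [← h]
      rw [char_orthonormal, if_pos ⟨.refl ρ⟩]
    · rw [char_orthonormal, if_neg]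
      rintro ⟨φ⟩
      exact h (Subtype.ext (char_iso φ).symm)
  rw [linearIndependent_iff']
  intro s c hc ψ hψ
  have h1 : (Nat.card G : ℂ)⁻¹ * ∑ g : G, (∑ χ ∈ s, c χ • χ.1) g * ψ.1 g⁻¹ = c ψ := by
    calc _ = ∑ χ ∈ s, c χ * ((Nat.card G : ℂ)⁻¹ * ∑ g : G, χ.1 g * ψ.1 g⁻¹) := by
          simp only [Finset.sum_apply, Pi.smul_apply, smul_eq_mul, Finset.sum_mul, Finset.mul_sum]
          rw [Finset.sum_comm]
          refine Finset.sum_congr rfl fun χ _ => Finset.sum_congr rfl fun g _ => by ring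
      _ = c ψ := by simp only [key, mul_ite, mul_one, mul_zero, Finset.sum_ite_eq', hψ, if_true]
  rw [← h1, hc]
  simp

instance Irr.finite (G : Type*) [Group G] [Finite G] : Finite (Irr G) :=
  (Irr.linearIndependent G).finite

theorem LinearMap.trace_eq_add_of_isCompl {V : Type*} [AddCommGroup V] [Module ℂ V]
    [FiniteDimensional ℂ V] {A B : Submodule ℂ V} (h : IsCompl A B) (f : V →ₗ[ℂ] V)
    (hA : ∀ v ∈ A, f v ∈ A) (hB : ∀ v ∈ B, f v ∈ B) :
    trace ℂ V f = trace ℂ A (f.restrict hA) + trace ℂ B (f.restrict hB) := by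
  rw [← trace_prodMap', ← trace_conj' _ (A.prodEquivOfIsCompl B h)]
  congr 1
  refine LinearMap.ext fun v => ?_
  obtain ⟨w, rfl⟩ := (A.prodEquivOfIsCompl B h).surjective v
  simp [LinearEquiv.conj_apply]

/-- Complete reducibility at the level of characters: by Maschke's theorem, every character is a sum
of irreducible ones. -/
theorem Representation.character_mem_closure_irr {G V : Type*} [Group G] [Finite G]
    [AddCommGroup V] [Module ℂ V] [FiniteDimensional ℂ V] (ρ : Representation ℂ G V) :
    ρ.character ∈ AddSubmonoid.closure (Irr G) := by
  induction hd : Module.finrank ℂ V using Nat.strong_induction_on generalizing V with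
  | _ d ih =>
  subst hd
  by_cases hρ : ρ.IsIrreducible
  · exact AddSubmonoid.subset_closure (ρ.character_mem_irr hρ)
  rcases subsingleton_or_nontrivial V with hV | hV
  · have : ρ.character = 0 := by
      ext g
      rw [character, Subsingleton.elim (ρ g) 0, map_zero]
      rfl
    rw [this]
    exact zero_mem _
  have hnot : ∃ A : Subrepresentation ρ, A.toSubmodule ≠ ⊥ ∧ A.toSubmodule ≠ ⊤ := by
    by_contra! hcon
    refine hρ ((isIrreducible_iff_submodule ρ).2 ⟨hV, fun W hW => ?_⟩)
    by_cases hb : W = ⊥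
    · exact .inl hb
    · exact .inr (hcon ⟨W, hW⟩ hb)
  obtain ⟨A, hA0, hA1⟩ := hnot
  have : NeZero (Nat.card G : ℂ) := ⟨by exact_mod_cast Nat.card_pos.ne'⟩
  obtain ⟨B, hAB⟩ := exists_isCompl A
  have hc : IsCompl A.toSubmodule B.toSubmodule := by
    rw [isCompl_iff, disjoint_iff, codisjoint_iff] at hAB ⊢
    exact ⟨congrArg Subrepresentation.toSubmodule hAB.1,
      congrArg Subrepresentation.toSubmodule hAB.2⟩
  have hsum : ρ.character = A.toRepresentation.character + B.toRepresentation.character := by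
    ext g
    exact LinearMap.trace_eq_add_of_isCompl hc (ρ g) (A.apply_mem_toSubmodule g)
      (B.apply_mem_toSubmodule g)
  rw [hsum]
  refine add_mem (ih _ ?_ _ rfl) (ih _ ?_ _ rfl)
  · exact Submodule.finrank_lt hA1
  · refine Submodule.finrank_lt fun hB => hA0 ?_
    have := hc.inf_eq_bot
    rwa [hB, inf_top_eq] at this

theorem Representation.exists_character_eq_sum {G V : Type*} [Group G] [Finite G] [Fintype (Irr G)]
    [AddCommGroup V] [Module ℂ V] [FiniteDimensional ℂ V] (ρ : Representation ℂ G V) :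
    ∃ f : Irr G → ℕ, ρ.character = ∑ χ, f χ • χ.1 := by
  classical
  have h := ρ.character_mem_closure_irr
  generalize ρ.character = φ at h
  induction h using AddSubmonoid.closure_induction with
  | mem x hx =>
    refine ⟨Pi.single ⟨x, hx⟩ 1, ?_⟩
    rw [Finset.sum_eq_single ⟨x, hx⟩] <;> simp +contextual
  | zero => exact ⟨0, by simp⟩
  | add x y _ _ hx hy =>
    obtain ⟨f, rfl⟩ := hx
    obtain ⟨g, rfl⟩ := hy
    exact ⟨f + g, by simp [add_smul, Finset.sum_add_distrib]⟩

/-! ### Weight multiplicities on an abelian normal subgroup -/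

/-- Weighted form of the congruence between the size of a set on which a `p`-group acts and its number
of fixed points. -/
theorem IsPGroup.dvd_sum_of_forall_mem_fixedPoints {p : ℕ} [Fact p.Prime] {H α : Type*} [Group H]
    [MulAction H α] [Fintype α] (hH : IsPGroup p H) (m : α → ℕ)
    (hm : ∀ (h : H) (a : α), m (h • a) = m a)
    (hfix : ∀ a ∈ MulAction.fixedPoints H α, p ∣ m a) : p ∣ ∑ a, m a := by
  classical
  rw [← Finset.sum_fiberwise Finset.univ
    (fun a => (Quotient.mk _ a : MulAction.orbitRel.Quotient H α))]
  refine Finset.dvd_sum fun ω _ => ?_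
  obtain ⟨a, rfl⟩ := Quotient.exists_rep ω
  have hiff : ∀ b : α, (Quotient.mk (MulAction.orbitRel H α) b = Quotient.mk _ a) ↔
      b ∈ MulAction.orbit H a := fun b => Quotient.eq.trans MulAction.orbitRel_apply
  have hconst : ∀ b ∈ Finset.univ.filter (fun b : α =>
      (Quotient.mk (MulAction.orbitRel H α) b = Quotient.mk _ a)), m b = m a := by
    intro b hb
    obtain ⟨h, rfl⟩ := (hiff b).1 (Finset.mem_filter.1 hb).2
    exact hm h a
  rw [Finset.sum_congr rfl hconst, Finset.sum_const, smul_eq_mul]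
  by_cases ha : a ∈ MulAction.fixedPoints H α
  · exact (hfix a ha).mul_left _
  · refine Dvd.dvd.mul_right ?_ _
    have hcard : (Finset.univ.filter (fun b : α =>
        (Quotient.mk (MulAction.orbitRel H α) b = Quotient.mk _ a))).card =
        Nat.card (MulAction.orbit H a) := by
      rw [Nat.card_eq_fintype_card, ← Set.toFinset_card]
      congr 1
      ext b
      simp [hiff]
    obtain ⟨n, hn⟩ := hH.card_orbit a
    rw [hcard, hn]
    refine dvd_pow_self p fun h0 => ha ?_
    rw [MulAction.mem_fixedPoints_iff_card_orbit_eq_one, ← Nat.card_eq_fintype_card, hn, h0,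
      pow_zero]

section LinearCharacters

variable {G : Type*} [Group G] {N : Subgroup G}

/-- The conjugation action of `G` on the linear characters of a normal subgroup,
`(g • μ) n = μ (g⁻¹ n g)`. -/
instance MonoidHom.conjMulAction [N.Normal] : MulAction G (N →* ℂˣ) where
  smul g μ := μ.comp (MulAut.conjNormal g⁻¹ : N ≃* N).toMonoidHom
  one_smul μ := by
    ext n
    change ((μ (MulAut.conjNormal (1 : G)⁻¹ n) : ℂˣ) : ℂ) = μ n
    simp
  mul_smul g h μ := by
    ext n
    change ((μ (MulAut.conjNormal (g * h)⁻¹ n) : ℂˣ) : ℂ) =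
      μ (MulAut.conjNormal h⁻¹ (MulAut.conjNormal g⁻¹ n))
    rw [mul_inv_rev, map_mul, MulAut.mul_apply]

theorem MonoidHom.conj_smul_apply [N.Normal] (g : G) (μ : N →* ℂˣ) (n : N) :
    (g • μ) n = μ (MulAut.conjNormal g⁻¹ n) := rfl

theorem MonoidHom.exists_units_apply_ne_one [Finite G] [IsMulCommutative N] {n : N} (hn : n ≠ 1) :
    ∃ μ : N →* ℂˣ, μ n ≠ 1 := by
  let : CommGroup N := { (inferInstance : Group N) with mul_comm := IsMulCommutative.is_comm.comm }
  exact CommGroup.exists_apply_ne_one_of_hasEnoughRootsOfUnity N ℂ hn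

theorem MonoidHom.conj_smul_eq_self_of_mem [N.Normal] [IsMulCommutative N] {g : G} (hg : g ∈ N)
    (μ : N →* ℂˣ) : g • μ = μ := by
  ext n
  rw [conj_smul_apply]
  congr 2
  apply Subtype.ext
  rw [MulAut.conjNormal_apply]
  have := congrArg Subtype.val (IsMulCommutative.is_comm.comm (⟨g, hg⟩ : N)⁻¹ n)
  simp only [Subgroup.coe_mul, Subgroup.coe_inv] at this
  rw [this]
  simp

/-- The inner product of the linear character `μ` of `N` with the restriction to `N` of a function `φ`
on `G`. When `φ` is a character, this is the multiplicity of `μ` in it. -/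
noncomputable def weightMult [Fintype N] (μ : N →* ℂˣ) (φ : G → ℂ) : ℂ :=
  (Nat.card N : ℂ)⁻¹ * ∑ n : N, ((μ n)⁻¹ : ℂˣ) * φ n

theorem weightMult_sum [Fintype N] {ι : Type*} (s : Finset ι) (μ : N →* ℂˣ) (f : ι → ℕ)
    (φ : ι → G → ℂ) :
    weightMult μ (∑ i ∈ s, f i • φ i) = ∑ i ∈ s, f i * weightMult μ (φ i) := by
  simp only [weightMult, Finset.sum_apply, nsmul_eq_mul, Finset.mul_sum]
  rw [Finset.sum_comm]
  exact Finset.sum_congr rfl fun i _ => Finset.sum_congr rfl fun n _ => by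
    rw [Pi.mul_apply, Pi.natCast_apply]; ring

theorem weightMult_smul [Fintype N] [N.Normal] (g : G) (μ : N →* ℂˣ) {φ : G → ℂ}
    (hφ : ∀ x y : G, φ (x * y * x⁻¹) = φ y) : weightMult (g • μ) φ = weightMult μ φ := by
  unfold weightMult
  congr 1
  refine Fintype.sum_equiv (MulAut.conjNormal g⁻¹ : N ≃* N).toEquiv _ _ fun n => ?_
  change ((((g • μ) n)⁻¹ : ℂˣ) : ℂ) * φ n = ((μ (MulAut.conjNormal g⁻¹ n))⁻¹ : ℂˣ) *
    φ (MulAut.conjNormal g⁻¹ n : N)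
  rw [MonoidHom.conj_smul_apply, MulAut.conjNormal_apply, hφ]

theorem map_weightMult [Fintype N] (τ : ℂ ≃+* ℂ) (μ : N →* ℂˣ) (φ : G → ℂ) :
    τ (weightMult μ φ) = weightMult ((Units.map (τ : ℂ →* ℂ)).comp μ) (τ ∘ φ) := by
  simp [weightMult]

/-- Column orthogonality for the abelian group `N`: when `φ` is a character, its degree is the sum of
the dimensions of its weight spaces. -/
theorem sum_weightMult [Finite G] [Fintype N] [IsMulCommutative N] [Fintype (N →* ℂˣ)]
    (φ : G → ℂ) : ∑ μ : N →* ℂˣ, weightMult μ φ = φ 1 := by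
  classical
  have horth : ∀ n : N, n ≠ 1 → ∑ μ : N →* ℂˣ, (((μ n)⁻¹ : ℂˣ) : ℂ) = 0 := by
    intro n hn
    obtain ⟨ν, hν⟩ := MonoidHom.exists_units_apply_ne_one hn
    have h1 : ∑ μ : N →* ℂˣ, (((μ n)⁻¹ : ℂˣ) : ℂ) =
        (((ν n)⁻¹ : ℂˣ) : ℂ) * ∑ μ : N →* ℂˣ, (((μ n)⁻¹ : ℂˣ) : ℂ) := by
      rw [Finset.mul_sum]
      refine (Fintype.sum_equiv (Equiv.mulLeft ν) _ _ fun μ => ?_).symm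
      simp [mul_comm]
    have h2 : (((ν n)⁻¹ : ℂˣ) : ℂ) ≠ 1 := fun h => hν (inv_eq_one.1 (Units.ext h))
    -- the sum is unchanged by the substitution `μ ↦ ν * μ`, which multiplies it by `(ν n)⁻¹ ≠ 1`
    by_contra h0
    exact h2 (mul_right_cancel₀ h0 (by rw [one_mul]; exact h1.symm))
  have hcard : (Fintype.card (N →* ℂˣ) : ℂ) = Nat.card N := by
    let : CommGroup N :=
      { (inferInstance : Group N) with mul_comm := IsMulCommutative.is_comm.comm }
    rw [← CommGroup.card_monoidHom_of_hasEnoughRootsOfUnity N ℂ, Nat.card_eq_fintype_card]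
  have hN : (Nat.card N : ℂ) ≠ 0 := by exact_mod_cast Nat.card_pos.ne'
  simp only [weightMult, ← Finset.mul_sum]
  rw [Finset.sum_comm]
  simp only [← Finset.sum_mul]
  rw [Finset.sum_eq_single 1 (fun n _ hn => by rw [horth n hn, zero_mul]) (by simp)]
  simp only [map_one, inv_one, Units.val_one, Finset.sum_const, Finset.card_univ, nsmul_eq_mul,
    mul_one, Subgroup.coe_one]
  rw [hcard, ← mul_assoc, inv_mul_cancel₀ hN, one_mul]

/-- The multiplicity of `μ` in a character is a natural number, namely the dimension of the space of
`N`-invariants of the representation twisted by `μ⁻¹`; if it is not zero, `μ` is a weight. -/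
theorem Representation.exists_weightMult_eq [Fintype N] {V : Type*} [AddCommGroup V] [Module ℂ V]
    [FiniteDimensional ℂ V] (ρ : Representation ℂ G V) (μ : N →* ℂˣ) :
    ∃ k : ℕ, weightMult μ ρ.character = k ∧
      (k ≠ 0 → ∃ v : V, v ≠ 0 ∧ ∀ n : N, ρ n v = (μ n : ℂ) • v) := by
  let ρ' : Representation ℂ N V :=
    { toFun := fun n => (((μ n)⁻¹ : ℂˣ) : ℂ) • ρ n
      map_one' := by simp
      map_mul' := fun a b => by
        rw [map_mul, mul_inv, Subgroup.coe_mul, map_mul, smul_mul_smul_comm, Units.val_mul] }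
  have hρ' : ∀ n v, ρ' n v = (((μ n)⁻¹ : ℂˣ) : ℂ) • ρ n v := fun n v => rfl
  have : Invertible (Nat.card N : ℂ) :=
    invertibleOfNonzero (by exact_mod_cast Nat.card_pos.ne')
  refine ⟨Module.finrank ℂ ρ'.invariants, ?_, fun hk => ?_⟩
  · rw [← card_inv_mul_sum_char_eq_finrank, weightMult]
    congr 1
    refine Finset.sum_congr rfl fun n _ => ?_
    exact (map_smul (LinearMap.trace ℂ V) _ (ρ n)).symm
  · have := Module.nontrivial_of_finrank_pos (Nat.pos_of_ne_zero hk)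
    obtain ⟨v, hv⟩ := exists_ne (0 : ρ'.invariants)
    refine ⟨v, fun h => hv (Subtype.ext h), fun n => ?_⟩
    have h := v.2 n
    rw [hρ'] at h
    calc ρ n v = (μ n : ℂ) • ((((μ n)⁻¹ : ℂˣ) : ℂ) • ρ n v) := by
          rw [smul_smul, ← Units.val_mul, mul_inv_cancel, Units.val_one, one_smul]
      _ = _ := by rw [h]

/-- If `N` and `NP` are normal in `G`, with `N` abelian and `P` a `p`-group, then an irreducible
representation of `G` having a weight on `N` not fixed by `P` has degree divisible by `p`. The
subspace fixed by `[N, NP]` is a subrepresentation, and it is not everything since the given weight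
is nontrivial on `[N, NP]`; hence it is zero and no weight is fixed by `P`. -/
theorem Representation.dvd_finrank_of_weight_ne [Finite G] {p : ℕ} [Fact p.Prime] [N.Normal]
    [IsMulCommutative N] {P : Subgroup G} (hP : IsPGroup p P) (hK : (N ⊔ P).Normal)
    {V : Type*} [AddCommGroup V] [Module ℂ V] [FiniteDimensional ℂ V]
    (ρ : Representation ℂ G V) (hρ : ρ.IsIrreducible) (μ : N →* ℂˣ)
    (hμ : ∃ x ∈ P, x • μ ≠ μ) {v : V} (hv : v ≠ 0) (hvμ : ∀ n : N, ρ n v = (μ n : ℂ) • v) :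
    p ∣ Module.finrank ℂ V := by
  classical
  have := Fintype.ofFinite N
  have := Fintype.ofFinite (N →* ℂˣ)
  have hMn : (⁅N, N ⊔ P⁆).Normal := Subgroup.commutator_normal _ _
  -- the fixed vectors of `[N, NP]`, a `G`-stable subspace since `[N, NP]` is normal
  let W : Submodule ℂ V :=
    { carrier := {w | ∀ m ∈ ⁅N, N ⊔ P⁆, ρ m w = w}
      add_mem' := fun {a b} ha hb m hm => by rw [map_add, ha m hm, hb m hm]
      zero_mem' := fun m _ => map_zero _
      smul_mem' := fun c a ha m hm => by rw [map_smul, ha m hm] }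
  have hW : ∀ w, w ∈ W ↔ ∀ m ∈ ⁅N, N ⊔ P⁆, ρ m w = w := fun w => Iff.rfl
  have hWbot : W = ⊥ := by
    refine (((isIrreducible_iff_submodule ρ).1 hρ).2 W fun g w hw m hm => ?_).resolve_right
      fun htop => ?_
    · have h1 := hw _ (hMn.conj_mem m hm g⁻¹)
      rw [inv_inv, map_mul, map_mul, Module.End.mul_apply, Module.End.mul_apply] at h1
      have h2 := congrArg (ρ g) h1
      rwa [self_inv_apply] at h2
    · obtain ⟨x, hx, hne⟩ := hμ
      refine hne ?_
      ext n
      have hxn : ⁅(n : G), x⁻¹⁆ ∈ ⁅N, N ⊔ P⁆ :=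
        Subgroup.commutator_mem_commutator n.2 (Subgroup.mem_sup_right (P.inv_mem hx))
      have hvW : v ∈ W := htop ▸ Submodule.mem_top
      have h1 := (hW v).1 hvW _ hxn
      have h2 : ⁅(n : G), x⁻¹⁆ = (n * (MulAut.conjNormal x⁻¹ n)⁻¹ : N) := by
        simp [commutatorElement_def, mul_assoc]
      rw [h2, hvμ] at h1
      have h3 : ((μ (n * (MulAut.conjNormal x⁻¹ n)⁻¹) : ℂˣ) : ℂ) = 1 :=
        smul_left_injective ℂ hv (by simpa using h1)
      rw [map_mul, map_inv] at h3
      rw [MonoidHom.conj_smul_apply, ← mul_inv_eq_one.1 (Units.ext h3)]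
  choose k hk hk' using fun μ : N →* ℂˣ => ρ.exists_weightMult_eq μ
  have hsum : Module.finrank ℂ V = ∑ μ, k μ := by
    have := sum_weightMult (N := N) ρ.character
    simp only [hk, char_one] at this
    exact_mod_cast this.symm
  rw [hsum]
  refine hP.dvd_sum_of_forall_mem_fixedPoints k (fun h ν => ?_) fun ν hν => ?_
  · have := weightMult_smul (h : G) ν (φ := ρ.character) fun x y => char_conj ρ y x
    rw [hk, hk] at this
    exact_mod_cast this
  · rcases eq_or_ne (k ν) 0 with h0 | h0
    · rw [h0]; exact dvd_zero p
    obtain ⟨w, hw0, hw⟩ := hk' ν h0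
    refine absurd ((Submodule.mem_bot ℂ).1 (hWbot ▸ (hW w).2 ?_)) hw0
    have hstab : N ⊔ P ≤ MulAction.stabilizer G ν :=
      sup_le (fun g hg => MonoidHom.conj_smul_eq_self_of_mem hg ν) fun g hg => hν ⟨g, hg⟩
    let S : Subgroup G :=
      { carrier := {m | ρ m w = w}
        one_mem' := by simp
        mul_mem' := fun {a b} ha hb => by
          change ρ (a * b) w = w
          rw [map_mul, Module.End.mul_apply, show ρ b w = w from hb, show ρ a w = w from ha]
        inv_mem' := fun {a} ha => by
          change ρ a⁻¹ w = w
          conv_lhs => rw [← show ρ a w = w from ha]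
          exact inv_self_apply ρ a w }
    have hS : ⁅N, N ⊔ P⁆ ≤ S := by
      refine Subgroup.commutator_le.2 fun n hn y hy => ?_
      have h2 : ⁅n, y⁆ = ((⟨n, hn⟩ : N) * (MulAut.conjNormal y ⟨n, hn⟩)⁻¹ : N) := by
        simp [commutatorElement_def, mul_assoc]
      have h3 : ν (MulAut.conjNormal y ⟨n, hn⟩) = ν ⟨n, hn⟩ := by
        have h4 : y⁻¹ • ν = ν := (MulAction.stabilizer G ν).inv_mem (hstab hy)
        conv_rhs => rw [← h4]
        rw [MonoidHom.conj_smul_apply, inv_inv]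
      change ρ ⁅n, y⁆ w = w
      rw [h2, hw, map_mul, map_inv, h3, mul_inv_cancel, Units.val_one, one_smul]
    exact fun m hm => hS hm

end LinearCharacters

/-! ### A Galois-invariant constituent of the permutation character on a Sylow subgroup -/

section PermutationCharacter

variable {G X : Type*} [Group G] [MulAction G X]

/-- The permutation representation of `G` on the functions on a `G`-set `X`. -/
def Representation.functionsOn (G X : Type*) [Group G] [MulAction G X] :
    Representation ℂ G (X → ℂ) where
  toFun g := LinearMap.funLeft ℂ ℂ fun x : X => g⁻¹ • x
  map_one' := by ext; simp [LinearMap.funLeft_apply]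
  map_mul' g h := LinearMap.ext fun f => by
    ext x
    simp [LinearMap.funLeft_apply, mul_smul]

theorem Representation.character_functionsOn [Fintype X] (g : G) [DecidableEq X] :
    (functionsOn G X).character g =
      ((Finset.univ.filter fun x : X => g⁻¹ • x = x).card : ℂ) := by
  rw [character, LinearMap.trace_eq_matrix_trace ℂ (Pi.basisFun ℂ X), Matrix.trace,
    Finset.card_filter, Nat.cast_sum]
  refine Finset.sum_congr rfl fun x _ => ?_
  simp [functionsOn, LinearMap.funLeft_apply, Pi.single_apply]

end PermutationCharacter

/-- The multiplicity of `μ` in the permutation character on `G ⧸ P` is `|G : P| / |N|`, which is prime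
to `p`; counting it over the orbits of `τ` on the irreducible constituents shows that `μ` is a weight
of a `τ`-invariant one. -/
theorem Irr.exists_galois_fixed_dvd_degree {G : Type*} [Group G] [Finite G] {p : ℕ}
    [Fact p.Prime] {N : Subgroup G} [N.Normal] [IsMulCommutative N] (P : Sylow p G)
    (hNP : N ⊓ P = ⊥) (hK : (N ⊔ P).Normal) (τ : ℂ ≃+* ℂ)
    (hτ : Irr.galoisPerm (G := G) τ ^ p = 1) (μ : N →* ℂˣ)
    (hμ : ∃ x ∈ P, x • μ ≠ μ) (hτμ : ∃ x : G, x • μ = (Units.map (τ : ℂ →* ℂ)).comp μ) :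
    ∃ χ : Irr G, τ ∘ χ.1 = χ.1 ∧ p ∣ Irr.degree χ := by
  classical
  have := Fintype.ofFinite N
  have := Fintype.ofFinite (G ⧸ (P : Subgroup G))
  have := Fintype.ofFinite (Irr G)
  let e := Irr.galoisPerm (G := G) τ
  obtain ⟨f, hf⟩ := (functionsOn G (G ⧸ (P : Subgroup G))).exists_character_eq_sum
  have hclass : ∀ (χ : Irr G) (x y : G), χ.1 (x * y * x⁻¹) = χ.1 y := by
    rintro ⟨_, n, ρ, -, rfl⟩ x y
    exact char_conj ρ y x
  have hk : ∀ χ : Irr G, ∃ k : ℕ, weightMult μ χ.1 = k ∧ (k ≠ 0 → p ∣ Irr.degree χ) := by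
    rintro ⟨_, n, ρ, hρ, rfl⟩
    obtain ⟨k, hk, hk'⟩ := ρ.exists_weightMult_eq μ
    refine ⟨k, hk, fun h0 => ?_⟩
    obtain ⟨v, hv, hvμ⟩ := hk' h0
    rw [Irr.degree_eq ⟨ρ.character, n, ρ, hρ, rfl⟩ (char_one ρ)]
    exact ρ.dvd_finrank_of_weight_ne P.isPGroup' hK hρ μ hμ hv hvμ
  choose k hk hk' using hk
  -- applying `τ` to the integer `k χ` gives the multiplicity of `τ ∘ μ = x • μ` in `e χ`
  have hke : ∀ χ, k (e χ) = k χ := by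
    intro χ
    obtain ⟨x, hx⟩ := hτμ
    have h1 : τ (weightMult μ χ.1) = weightMult (x • μ) (e χ).1 :=
      (map_weightMult τ μ χ.1).trans (congrArg (weightMult · _) hx.symm)
    rw [weightMult_smul x μ (hclass (e χ)), hk, hk, map_natCast] at h1
    exact_mod_cast h1.symm
  -- the permutation character has values in `ℕ`, so its coefficients are invariant under `e`
  have hfe : ∀ χ, f (e χ) = f χ := by
    have hval : ∀ g, (functionsOn G (G ⧸ (P : Subgroup G))).character g = ∑ χ, f χ * χ.1 g :=
      fun g => by simp [hf]
    have h1 : ∑ χ, ((f (e.symm χ) : ℂ) - f χ) • χ.1 = 0 := by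
      ext g
      have h2 : τ ((functionsOn G (G ⧸ (P : Subgroup G))).character g) =
          (functionsOn G (G ⧸ (P : Subgroup G))).character g := by
        rw [character_functionsOn, map_natCast]
      have h3 : τ (∑ χ, f χ * χ.1 g) = ∑ χ, f (e.symm χ) * χ.1 g := by
        rw [← Equiv.sum_comp e (fun χ : Irr G => (f (e.symm χ) : ℂ) * χ.1 g), map_sum]
        refine Finset.sum_congr rfl fun χ _ => ?_
        rw [map_mul, map_natCast, Equiv.symm_apply_apply]
        rfl
      rw [hval, h3] at h2
      simp only [Finset.sum_apply, Pi.smul_apply, smul_eq_mul, sub_mul, Finset.sum_sub_distrib,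
        Pi.zero_apply]
      exact sub_eq_zero.2 h2
    have h4 := Fintype.linearIndependent_iff.1 (Irr.linearIndependent G) _ h1
    intro χ
    have h5 := h4 (e χ)
    rw [Equiv.symm_apply_apply, sub_eq_zero] at h5
    exact_mod_cast h5.symm
  -- an element `n ≠ 1` of `N` fixes no point of `G ⧸ P`, because `N ⊓ P = ⊥`
  have hindex : (∑ χ, f χ * k χ) * Nat.card N = (P : Subgroup G).index := by
    have h1 : weightMult μ (functionsOn G (G ⧸ (P : Subgroup G))).character =
        (Nat.card N : ℂ)⁻¹ * (P : Subgroup G).index := by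
      rw [weightMult, Finset.sum_eq_single 1 (fun n _ hn => ?_) (by simp)]
      · simp [Subgroup.index, Nat.card_eq_fintype_card]
      · rw [character_functionsOn, Finset.filter_eq_empty_iff.2, Finset.card_empty, Nat.cast_zero,
          mul_zero]
        intro x _ hx
        obtain ⟨g, rfl⟩ := QuotientGroup.mk_surjective x
        have h2 : g⁻¹ * n * g ∈ (P : Subgroup G) := by
          have := QuotientGroup.eq.1 hx
          simpa [mul_assoc] using this
        have h3 : g⁻¹ * n * g ∈ N := by
          simpa using (inferInstance : N.Normal).conj_mem n n.2 g⁻¹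
        have h4 : g⁻¹ * n * g ∈ N ⊓ (P : Subgroup G) := ⟨h3, h2⟩
        rw [hNP, Subgroup.mem_bot] at h4
        refine hn (Subtype.ext ?_)
        have h5 : (n : G) = g * (g⁻¹ * n * g) * g⁻¹ := by group
        rw [h5, h4]
        simp
    rw [hf, weightMult_sum] at h1
    simp only [hk] at h1
    have hN : (Nat.card N : ℂ) ≠ 0 := by exact_mod_cast Nat.card_pos.ne'
    have h2 : (∑ χ, (f χ : ℂ) * k χ) * Nat.card N = (P : Subgroup G).index := by
      rw [h1]; field_simp
    exact_mod_cast h2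
  by_contra! hcon
  have hpgroup : IsPGroup p (Subgroup.zpowers e) := by
    rintro ⟨_, i, rfl⟩
    refine ⟨1, Subtype.ext ?_⟩
    change (e ^ i) ^ p ^ 1 = 1
    rw [pow_one, ← zpow_natCast, zpow_comm, zpow_natCast, hτ, one_zpow]
  have hinv : ∀ m : Irr G → ℕ, (∀ χ, m (e χ) = m χ) →
      ∀ (h : Subgroup.zpowers e) (χ : Irr G), m (h • χ) = m χ := by
    rintro m hm ⟨_, i, rfl⟩ χ
    change m ((e ^ i) χ) = m χ
    induction i using Int.induction_on generalizing χ with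
    | zero => rfl
    | succ i ih => rw [zpow_add_one, Equiv.Perm.mul_apply, ih, hm]
    | pred i ih => rw [zpow_sub_one, Equiv.Perm.mul_apply, ih, ← hm, Equiv.Perm.inv_def,
        Equiv.apply_symm_apply]
  have hdvd : p ∣ ∑ χ, f χ * k χ := by
    refine hpgroup.dvd_sum_of_forall_mem_fixedPoints _
      (hinv (fun χ => f χ * k χ) fun χ => by rw [hfe, hke]) fun χ hχ => ?_
    have h1 : e χ = χ := hχ ⟨e, Subgroup.mem_zpowers e⟩
    have h2 := hcon χ (congrArg Subtype.val h1)
    have h3 : k χ = 0 := by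
      by_contra h0
      exact h2 (hk' χ h0)
    rw [h3, mul_zero]
    exact dvd_zero p
  exact P.not_dvd_index (hindex ▸ hdvd.mul_right _)

/-! ### A linear character whose Galois conjugate is a group conjugate -/

/-- The polynomial `X ^ p - 1` has distinct roots in `F`; if `T - ζ` were injective for each root
`ζ ≠ 1`, the factorization of `T ^ p - 1 = 0` would give `T - 1 = 0`. -/
theorem Module.End.exists_eigenvector_of_pow_prime_eq_one {F V : Type*} [Field F] [AddCommGroup V]
    [Module F V] {p : ℕ} [Fact p.Prime] {s : F} (hs : IsPrimitiveRoot s p) {T : Module.End F V}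
    (hT : T ^ p = 1) (hT1 : T ≠ 1) :
    ∃ ζ : F, ζ ^ p = 1 ∧ ζ ≠ 1 ∧ ∃ v : V, v ≠ 0 ∧ T v = ζ • v := by
  classical
  have hp : 0 < p := (Fact.out : p.Prime).pos
  by_contra! hcon
  have hinj : ∀ S : Finset F, (∀ ζ ∈ S, ζ ^ p = 1 ∧ ζ ≠ 1) → ∀ v : V,
      Polynomial.aeval T (∏ ζ ∈ S, (Polynomial.X - Polynomial.C ζ)) v = 0 → v = 0 := by
    intro S
    induction S using Finset.induction_on with
    | empty => intro _ v hv; simpa using hv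
    | insert ζ S hζ ih =>
      intro hS v hv
      rw [Finset.prod_insert hζ, map_mul, Module.End.mul_apply] at hv
      refine ih (fun ξ hξ => hS ξ (Finset.mem_insert_of_mem hξ)) v ?_
      by_contra hne
      obtain ⟨h1, h2⟩ := hS ζ (Finset.mem_insert_self _ _)
      refine hcon ζ h1 h2 _ hne ?_
      simpa [sub_eq_zero] using hv
  refine hT1 (LinearMap.ext fun v => ?_)
  have hprod := Polynomial.X_pow_sub_one_eq_prod hp hs
  have h1mem : (1 : F) ∈ Polynomial.nthRootsFinset p (1 : F) := by
    rw [Polynomial.mem_nthRootsFinset hp, one_pow]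
  rw [← Finset.prod_erase_mul _ _ h1mem] at hprod
  have h0 := congrArg (fun f => Polynomial.aeval T f v) hprod
  simp only [map_sub, map_pow, Polynomial.aeval_X, map_one, hT, sub_self, map_mul,
    Module.End.mul_apply] at h0
  have h2 := hinj ((Polynomial.nthRootsFinset p (1 : F)).erase 1) (fun ζ hζ => by
    rw [Finset.mem_erase, Polynomial.mem_nthRootsFinset hp] at hζ
    exact ⟨hζ.2, hζ.1⟩) _ h0.symm
  simpa [sub_eq_zero] using h2

/-- Any `p`-th root of unity `s ≠ 1` is a power of any other one, so some iterate of `T` has the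
eigenvalue `s`, on a vector that `T` moves. -/
theorem LinearMap.exists_iterate_apply_eq_smul {F V : Type*} [Field F] [AddCommGroup V]
    [Module F V] {p : ℕ} [Fact p.Prime] {s : F} (hs : s ^ p = 1) (hs1 : s ≠ 1) (T : V →ₗ[F] V)
    (hT : ∀ x, T^[p] x = x) (hT1 : ∃ x, T x ≠ x) :
    ∃ v : V, T v ≠ v ∧ ∃ i : ℕ, T^[i] v = s • v := by
  have hprim : ∀ ζ : F, ζ ^ p = 1 → ζ ≠ 1 → IsPrimitiveRoot ζ p := fun ζ h h1 => by
    have := IsPrimitiveRoot.orderOf ζ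
    rwa [orderOf_eq_prime h h1] at this
  obtain ⟨ζ, hζ, hζ1, v, hv, hTv⟩ :=
    Module.End.exists_eigenvector_of_pow_prime_eq_one (hprim _ hs hs1) (T := T)
      (LinearMap.ext fun x => by rw [Module.End.pow_apply, hT]; rfl) fun h => by
        obtain ⟨x, hx⟩ := hT1
        exact hx (LinearMap.congr_fun h x)
  have : NeZero p := ⟨(Fact.out : p.Prime).ne_zero⟩
  obtain ⟨i, -, hi⟩ := (hprim ζ hζ hζ1).eq_pow_of_pow_eq_one hs
  refine ⟨v, fun h => ?_, i, ?_⟩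
  · rw [hTv] at h
    have h2 : (ζ - 1) • v = 0 := by rw [sub_smul, h, one_smul, sub_self]
    exact (smul_eq_zero.1 h2).elim (fun h => hζ1 (sub_eq_zero.1 h)) hv
  · rw [← hi]
    clear hi
    induction i with
    | zero => simp
    | succ i ih => rw [Function.iterate_succ_apply', ih, map_smul, hTv, smul_smul, pow_succ]

theorem AddMonoidHom.exists_iterate_apply_eq_nsmul {A : Type*} [AddCommGroup A] {p q s : ℕ}
    [Fact p.Prime] [Fact q.Prime] (hA : ∀ x : A, q • x = 0) (hs : (s : ZMod q) ^ p = 1)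
    (hs1 : (s : ZMod q) ≠ 1) (T : A →+ A) (hT : ∀ x, T^[p] x = x) (hT1 : ∃ x, T x ≠ x) :
    ∃ v : A, T v ≠ v ∧ ∃ i : ℕ, T^[i] v = s • v := by
  let : Module (ZMod q) A := AddCommGroup.zmodModule hA
  obtain ⟨v, hv, i, hi⟩ :=
    LinearMap.exists_iterate_apply_eq_smul hs hs1 (T.toZModLinearMap q) hT hT1
  exact ⟨v, hv, i, hi.trans (Nat.cast_smul_eq_nsmul (ZMod q) s v)⟩

/-- If the `p`-group `P` does not centralize the abelian group `N` of exponent `q`, then some linear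
character of `N` not fixed by `P` has its Galois conjugate under `τ` in its own `G`-orbit. -/
theorem exists_linearCharacter_galois_conj {G : Type*} [Group G] [Finite G] {p q : ℕ}
    [Fact p.Prime] [Fact q.Prime] {N : Subgroup G} [N.Normal] [IsMulCommutative N]
    (hN : ∀ n : N, n ^ q = 1) {P : Subgroup G} (hP : IsPGroup p P)
    (hPN : ∃ x ∈ P, ∃ n ∈ N, x * n ≠ n * x) (τ : ℂ ≃+* ℂ)
    (hτ : ∀ z : ℂ, z ^ q = 1 → τ^[p] z = z) :
    ∃ μ : N →* ℂˣ, (∃ x ∈ P, x • μ ≠ μ) ∧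
      ∃ x : G, x • μ = (Units.map (τ : ℂ →* ℂ)).comp μ := by
  obtain ⟨y, hy, μ₀, hμ₀⟩ : ∃ y ∈ P, ∃ μ : N →* ℂˣ, y • μ ≠ μ := by
    obtain ⟨x, hx, n, hn, hne⟩ := hPN
    by_contra! hcon
    have h1 : (MulAut.conjNormal x ⟨n, hn⟩ : N) * (⟨n, hn⟩ : N)⁻¹ ≠ 1 := by
      intro h
      have h2 := congrArg Subtype.val (mul_inv_eq_one.1 h)
      rw [MulAut.conjNormal_apply] at h2
      exact hne (mul_inv_eq_iff_eq_mul.1 h2)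
    obtain ⟨μ, hμ⟩ := MonoidHom.exists_units_apply_ne_one h1
    refine hμ ?_
    have h3 := DFunLike.congr_fun (hcon x⁻¹ (P.inv_mem hx) μ) ⟨n, hn⟩
    rw [MonoidHom.conj_smul_apply, inv_inv] at h3
    rw [map_mul, map_inv, h3, mul_inv_cancel]
  have hD : ∀ μ : N →* ℂˣ, μ ^ q = 1 := by
    intro μ
    ext n
    rw [MonoidHom.pow_apply, ← map_pow, hN, map_one, MonoidHom.one_apply]
  have hq0 : q ≠ 0 := (Fact.out : q.Prime).ne_zero
  have : NeZero q := ⟨hq0⟩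
  have hω := Complex.isPrimitiveRoot_exp q hq0
  set ω := Complex.exp (2 * Real.pi * Complex.I / q)
  -- `τ` raises the `q`-th roots of unity to the power `s`
  obtain ⟨s, -, hs⟩ : ∃ s < q, ω ^ s = τ ω :=
    hω.eq_pow_of_pow_eq_one (by rw [← map_pow, hω.pow_eq_one, map_one])
  have hτs : ∀ z : ℂ, z ^ q = 1 → τ z = z ^ s := by
    intro z hz
    obtain ⟨j, -, rfl⟩ := hω.eq_pow_of_pow_eq_one hz
    rw [map_pow, ← hs, ← pow_mul, ← pow_mul, mul_comm]
  have hτμ : ∀ μ : N →* ℂˣ, (Units.map (τ : ℂ →* ℂ)).comp μ = μ ^ s := by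
    intro μ
    ext n
    refine hτs _ ?_
    have := congrArg Units.val (DFunLike.congr_fun (hD μ) n)
    simpa using this
  have hsp : ((s : ZMod q)) ^ p = 1 := by
    have h1 : ∀ i : ℕ, τ^[i] ω = ω ^ s ^ i := by
      intro i
      induction i with
      | zero => simp
      | succ i ih => rw [Function.iterate_succ_apply', ih, map_pow, ← hs, ← pow_mul, pow_succ']
    have h2 := h1 p
    rw [hτ ω hω.pow_eq_one] at h2
    have h3 : ω ^ 1 = ω ^ s ^ p := by rw [pow_one]; exact h2
    have hfin : IsOfFinOrder ω :=
      isOfFinOrder_iff_pow_eq_one.2 ⟨q, Nat.pos_of_ne_zero hq0, hω.pow_eq_one⟩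
    rw [hfin.pow_eq_pow_iff_modEq, ← hω.eq_orderOf, ← ZMod.natCast_eq_natCast_iff] at h3
    exact_mod_cast h3.symm
  by_cases hs1 : (s : ZMod q) = 1
  · refine ⟨μ₀, ⟨y, hy, hμ₀⟩, 1, ?_⟩
    have h1 : s ≡ 1 [MOD q] := by
      rw [← ZMod.natCast_eq_natCast_iff]; exact_mod_cast hs1
    rw [one_smul, hτμ]
    refine MonoidHom.ext fun n => ?_
    rw [MonoidHom.pow_apply, pow_eq_pow_of_modEq h1 (DFunLike.congr_fun (hD μ₀) n), pow_one]
  · obtain ⟨z, hz, ⟨ν, hν⟩, hzp⟩ : ∃ z ∈ P, (∃ μ : N →* ℂˣ, z • μ ≠ μ) ∧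
        ∀ μ : N →* ℂˣ, z ^ p • μ = μ := by
      classical
      have hex : ∃ a : ℕ, ∀ μ : N →* ℂˣ, y ^ p ^ a • μ = μ := by
        obtain ⟨a, ha⟩ := hP ⟨y, hy⟩
        have ha' : y ^ p ^ a = 1 := congrArg Subtype.val ha
        exact ⟨a, fun μ => by rw [ha', one_smul]⟩
      -- the least `a + 1` such that `y ^ p ^ (a + 1)` acts trivially; then `y ^ p ^ a` acts with
      -- order `p`
      obtain ⟨a, ha⟩ : ∃ a, Nat.find hex = a + 1 := by
        refine Nat.exists_eq_succ_of_ne_zero fun h0 => hμ₀ ?_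
        simpa [h0] using Nat.find_spec hex μ₀
      have hmin := Nat.find_min hex (m := a) (by lia)
      push Not at hmin
      refine ⟨y ^ p ^ a, P.pow_mem hy _, hmin, fun μ => ?_⟩
      rw [← pow_mul, ← pow_succ, ← ha]
      exact Nat.find_spec hex μ
    let T : Additive (N →* ℂˣ) →+ Additive (N →* ℂˣ) :=
      { toFun := fun μ => .ofMul (z • μ.toMul), map_zero' := rfl, map_add' := fun _ _ => rfl }
    have hT : ∀ (i : ℕ) (μ : Additive (N →* ℂˣ)), T^[i] μ = .ofMul (z ^ i • μ.toMul) := by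
      intro i
      induction i with
      | zero => intro μ; simp
      | succ i ih => intro μ; rw [Function.iterate_succ_apply, ih, pow_succ, mul_smul]; rfl
    obtain ⟨μ, hμ, i, hi⟩ := AddMonoidHom.exists_iterate_apply_eq_nsmul
      (A := Additive (N →* ℂˣ)) (fun μ => hD μ.toMul) hsp hs1 T
      (fun μ => by rw [hT, hzp, ofMul_toMul]) ⟨.ofMul ν, hν⟩
    refine ⟨μ.toMul, ⟨z, hz, hμ⟩, z ^ i, ?_⟩
    rw [hτμ]
    rw [hT] at hi
    exact hi

/-! ### Group theory, extension of field automorphisms, and the induction -/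

/-- The elements of order dividing `q` in the last nontrivial term of the derived series, for a prime
`q` dividing its order. -/
theorem Subgroup.exists_normal_isMulCommutative_pow_prime_eq_one (G : Type*) [Group G] [Finite G]
    [Group.IsSolvable G] [Nontrivial G] :
    ∃ (N : Subgroup G) (q : ℕ), q.Prime ∧ N.Normal ∧ IsMulCommutative N ∧ N ≠ ⊥ ∧
      ∀ n ∈ N, n ^ q = 1 := by
  classical
  have hex : ∃ k, derivedSeries G k = ⊥ := Group.IsSolvable.solvable
  obtain ⟨k, hk⟩ : ∃ k, Nat.find hex = k + 1 := by
    refine Nat.exists_eq_succ_of_ne_zero fun h0 => ?_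
    have h1 := Nat.find_spec hex
    rw [h0, derivedSeries_zero] at h1
    exact top_ne_bot h1
  let A := derivedSeries G k
  have hA : A ≠ ⊥ := Nat.find_min hex (by lia)
  have hcomm : ∀ a ∈ A, ∀ b ∈ A, a * b = b * a := by
    have h1 : ⁅A, A⁆ = ⊥ := by
      rw [← derivedSeries_succ, ← hk]
      exact Nat.find_spec hex
    intro a ha b hb
    have h2 := Subgroup.commutator_mem_commutator ha hb
    rw [h1, Subgroup.mem_bot] at h2
    exact commutatorElement_eq_one_iff_mul_comm.1 h2
  have hcard : Nat.card A ≠ 1 := fun h => hA (Subgroup.card_eq_one.1 h)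
  obtain ⟨q, hq, hdvd⟩ := Nat.exists_prime_and_dvd hcard
  have : Fact q.Prime := ⟨hq⟩
  obtain ⟨a, ha⟩ := exists_prime_orderOf_dvd_card' q hdvd
  let N : Subgroup G :=
    { carrier := {x | x ∈ A ∧ x ^ q = 1}
      one_mem' := ⟨A.one_mem, one_pow q⟩
      mul_mem' := fun {x y} hx hy => ⟨A.mul_mem hx.1 hy.1, by
        rw [(show Commute x y from hcomm x hx.1 y hy.1).mul_pow, hx.2, hy.2, one_mul]⟩
      inv_mem' := fun {x} hx => ⟨A.inv_mem hx.1, by rw [inv_pow, hx.2, inv_one]⟩ }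
  have hN : ∀ x, x ∈ N ↔ x ∈ A ∧ x ^ q = 1 := fun x => Iff.rfl
  refine ⟨N, q, hq, ⟨fun n hn g => ?_⟩, ⟨⟨fun a b => ?_⟩⟩, fun hbot => ?_, fun n hn => hn.2⟩
  · exact (hN _).2 ⟨(derivedSeries_normal G k).conj_mem n hn.1 g, by
      rw [conj_pow, hn.2, mul_one, mul_inv_cancel]⟩
  · exact Subtype.ext (hcomm a a.2.1 b b.2.1)
  · have h1 : (a : G) ∈ N := (hN _).2 ⟨a.2, by
      rw [← Subgroup.coe_pow, ← ha, pow_orderOf_eq_one, Subgroup.coe_one]⟩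
    rw [hbot, Subgroup.mem_bot, OneMemClass.coe_eq_one] at h1
    rw [h1, orderOf_one] at ha
    exact hq.one_lt.ne ha

theorem Irr.galoisPerm_pow_eq_one {G : Type*} [Group G] [Finite G] {p : ℕ} (τ : ℂ ≃+* ℂ)
    (hτ : ∀ z : ℂ, z ^ Nat.card G = 1 → τ^[p] z = z) : Irr.galoisPerm (G := G) τ ^ p = 1 := by
  have hcyc : ∀ z ∈ cyclotomicSubfield (Nat.card G), (τ ^ p : ℂ ≃+* ℂ) z = z := by
    intro z hz
    induction hz using IntermediateField.adjoin_induction with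
    | mem x hx =>
      have h := hτ x hx
      have : ∀ i : ℕ, (τ ^ i : ℂ ≃+* ℂ) x = τ^[i] x := fun i => by
        induction i with
        | zero => rfl
        | succ i ih => rw [pow_succ', RingAut.mul_apply, ih, Function.iterate_succ_apply']
      rw [this, h]
    | algebraMap x => simp
    | add x y _ _ hx hy => rw [map_add, hx, hy]
    | inv x _ hx => rw [map_inv₀, hx]
    | mul x y _ _ hx hy => rw [map_mul, hx, hy]
  have hpow : ∀ (i : ℕ) (χ : Irr G),
      ((Irr.galoisPerm (G := G) τ ^ i) χ).1 = (τ ^ i : ℂ ≃+* ℂ) ∘ χ.1 := by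
    intro i
    induction i with
    | zero => intro χ; rfl
    | succ i ih =>
      intro χ
      rw [pow_succ', Equiv.Perm.mul_apply, Irr.galoisPerm_apply, ih, pow_succ']
      rfl
  refine Equiv.ext fun χ => Subtype.ext ?_
  rw [hpow]
  ext g
  exact hcyc _ (Irr.mem_cyclotomicSubfield χ g)

/-- By the Frattini argument in `NP`, the normalizer of `P` is all of `G`. -/
theorem Sylow.normal_of_commute_of_sup_normal {G : Type*} [Group G] [Finite G] {p : ℕ}
    [Fact p.Prime] (P : Sylow p G) {N : Subgroup G} (hK : (N ⊔ P).Normal)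
    (hcomm : ∀ x ∈ P, ∀ n ∈ N, x * n = n * x) : (P : Subgroup G).Normal := by
  have hN : N ≤ Subgroup.normalizer (P : Set G) := by
    intro n hn
    refine Subgroup.mem_normalizer_iff.2 fun x => ⟨fun hx => ?_, fun hx => ?_⟩
    · rwa [← hcomm x hx n hn, mul_inv_cancel_right]
    · have h1 := hcomm _ hx n hn
      rw [inv_mul_cancel_right, mul_right_inj] at h1
      exact h1 ▸ hx
  have h := Sylow.normalizer_sup_eq_top' P (N := N ⊔ P) le_sup_right
  rw [sup_eq_left.2 (sup_le hN Subgroup.le_normalizer)] at h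
  exact Subgroup.normalizer_eq_top_iff.1 h

/-- The form of the theorem on which the induction runs: `τ` is an automorphism of `ℂ` whose `p`-th
iterate fixes the `|G|`-th roots of unity. -/
theorem Sylow.exists_normal_of_galois_fixed_not_dvd {p : ℕ} [Fact p.Prime] (τ : ℂ ≃+* ℂ)
    (G : Type*) [Group G] [Finite G] [Group.IsSolvable G]
    (hτ : ∀ z : ℂ, z ^ Nat.card G = 1 → τ^[p] z = z)
    (hG : ∀ χ : Irr G, τ ∘ χ.1 = χ.1 → ¬ p ∣ Irr.degree χ) :
    ∃ P : Sylow p G, (P : Subgroup G).Normal := by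
  induction hd : Nat.card G using Nat.strong_induction_on generalizing G with
  | _ d ih =>
  subst hd
  rcases subsingleton_or_nontrivial G with hsub | hnt
  · refine ⟨default, ?_⟩
    rw [Subsingleton.elim ((default : Sylow p G) : Subgroup G) ⊥]
    infer_instance
  obtain ⟨N, q, hq, hNn, hNc, hNbot, hNq⟩ :=
    Subgroup.exists_normal_isMulCommutative_pow_prime_eq_one G
  have : Fact q.Prime := ⟨hq⟩
  have hqdvd : q ∣ Nat.card G := by
    obtain ⟨n, hn, hn1⟩ := N.bot_or_exists_ne_one.resolve_left hNbot
    rw [← orderOf_eq_prime (hNq n hn) hn1]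
    exact orderOf_dvd_natCard n
  have hcard : Nat.card G = Nat.card (G ⧸ N) * Nat.card N :=
    N.card_eq_card_quotient_mul_card_subgroup
  have hNcard : 1 < Nat.card N := N.one_lt_card_iff_ne_bot.2 hNbot
  have hlt : Nat.card (G ⧸ N) < Nat.card G := by
    rw [hcard]
    exact lt_mul_of_one_lt_right Nat.card_pos hNcard
  obtain ⟨Q, hQ⟩ := ih _ hlt (G ⧸ N)
    (fun z hz => hτ z (by rw [hcard, pow_mul, hz, one_pow]))
    (fun χ hχ hdvd => by
      let χ' : Irr G := ⟨_, Irr.comp_mem (QuotientGroup.mk' N) (QuotientGroup.mk'_surjective N) χ⟩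
      have hdeg : Irr.degree χ' = Irr.degree χ := Irr.degree_eq χ' (by
        change χ.1 (QuotientGroup.mk' N 1) = _
        rw [map_one, Irr.eval_one])
      refine hG χ' ?_ (hdeg ▸ hdvd)
      change (τ ∘ χ.1) ∘ _ = _
      rw [hχ]) rfl
  have hNp : IsPGroup q N := fun n => ⟨1, Subtype.ext (by simpa using hNq n n.2)⟩
  by_cases hqp : q = p
  · subst hqp
    rw [← QuotientGroup.ker_mk' N] at hNp
    have hcomap := Q.isPGroup'.comap_of_ker_isPGroup (QuotientGroup.mk' N) hNp
    have hidx : ¬ q ∣ ((Q : Subgroup (G ⧸ N)).comap (QuotientGroup.mk' N)).index := by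
      rw [Subgroup.index_comap_of_surjective _ (QuotientGroup.mk'_surjective N)]
      exact Q.not_dvd_index
    exact ⟨hcomap.toSylow hidx, by rw [IsPGroup.toSylow_coe]; exact hQ.comap _⟩
  obtain ⟨P⟩ : Nonempty (Sylow p G) := inferInstance
  have hK : (N ⊔ (P : Subgroup G)).Normal := by
    have := Sylow.unique_of_normal Q hQ
    have h1 : ((P : Subgroup G).map (QuotientGroup.mk' N)) = Q := by
      rw [← Sylow.coe_mapSurjective (QuotientGroup.mk'_surjective N)]
      congr 1
      exact Subsingleton.elim _ _
    have h2 := Subgroup.comap_map_eq (QuotientGroup.mk' N) (P : Subgroup G)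
    rw [QuotientGroup.ker_mk', sup_comm] at h2
    rw [← h2, h1]
    exact hQ.comap _
  refine ⟨P, P.normal_of_commute_of_sup_normal hK ?_⟩
  by_contra! hcon
  have hNP : N ⊓ P = ⊥ := (IsPGroup.disjoint_of_ne q p hqp N P hNp P.isPGroup').eq_bot
  obtain ⟨μ, hμ, hτμ⟩ := exists_linearCharacter_galois_conj (q := q)
    (fun n => Subtype.ext (hNq n n.2)) P.isPGroup' hcon τ fun z hz => hτ z (by
      obtain ⟨c, hc⟩ := hqdvd
      rw [hc, pow_mul, hz, one_pow])
  obtain ⟨χ, hχ, hdvd⟩ := Irr.exists_galois_fixed_dvd_degree P hNP hK τ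
    (Irr.galoisPerm_pow_eq_one τ hτ) μ hμ hτμ
  exact hG χ hχ hdvd

/-- With a transcendence basis `v` of `ℂ` over `K`, the automorphism `σ` extends to `K[v]` by acting on
coefficients, and then to the algebraic closure `ℂ`. -/
theorem IntermediateField.exists_ringEquiv_extending (K : IntermediateField ℚ ℂ) (σ : K ≃ₐ[ℚ] K) :
    ∃ τ : ℂ ≃+* ℂ, ∀ x : K, τ x = σ x := by
  obtain ⟨ι, v, hv⟩ := exists_isTranscendenceBasis' K ℂ
  have := IsAlgClosed.isAlgClosure_of_transcendence_basis v hv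
  let e := hv.1.aevalEquiv
  let θ : Algebra.adjoin K (Set.range v) ≃+* Algebra.adjoin K (Set.range v) :=
    e.symm.toRingEquiv.trans ((MvPolynomial.mapEquiv ι σ.toRingEquiv).trans e.toRingEquiv)
  refine ⟨IsAlgClosure.equivOfEquiv ℂ ℂ θ, fun x => ?_⟩
  have h := IsAlgClosure.equivOfEquiv_algebraMap ℂ ℂ θ (algebraMap K _ x)
  have h1 : θ (algebraMap K _ x) = algebraMap K _ (σ x) := by
    simpa [θ, MvPolynomial.algebraMap_eq] using e.commutes (σ x)
  rw [h1] at h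
  exact h

theorem theoremA {G : Type*} [Group G] [Finite G] [Group.IsSolvable G] :
    (∀ (p : ℕ), p.Prime →
      ∀ σ : cyclotomicSubfield (Nat.card G) ≃ₐ[ℚ] cyclotomicSubfield (Nat.card G),
        orderOf σ = p →
        (∀ χ : Irr G, Irr.galConj χ σ = χ.1 → ¬ p ∣ Irr.degree χ) →
        ∃ P : Sylow p G, (P : Subgroup G).Normal) ∧
    ((∀ χ : Irr G, (∀ g : G, (χ.1 g).im = 0) → ¬ 2 ∣ Irr.degree χ) →
      ∃ P : Sylow 2 G, (P : Subgroup G).Normal) := by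
  constructor
  · intro p hp σ hσ hG
    have : Fact p.Prime := ⟨hp⟩
    obtain ⟨τ, hτ⟩ := IntermediateField.exists_ringEquiv_extending _ σ
    refine Sylow.exists_normal_of_galois_fixed_not_dvd τ G (fun z hz => ?_) fun χ hχ => hG χ ?_
    · have hpow : ∀ (i : ℕ) (x : cyclotomicSubfield (Nat.card G)), τ^[i] x = (σ ^ i) x := by
        intro i
        induction i with
        | zero => intro x; rfl
        | succ i ih =>
          intro x
          rw [Function.iterate_succ_apply, hτ, ih, pow_succ, AlgEquiv.mul_apply]
      have := hpow p ⟨z, IntermediateField.subset_adjoin _ _ hz⟩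
      rwa [← hσ, pow_orderOf_eq_one, hσ] at this
    · refine Eq.trans ?_ hχ
      ext g
      exact (hτ ⟨χ.1 g, Irr.mem_cyclotomicSubfield χ g⟩).symm
  · intro hG
    refine Sylow.exists_normal_of_galois_fixed_not_dvd (starRingAut (R := ℂ)) G (fun z _ => ?_)
      fun χ hχ => hG χ fun g => Complex.conj_eq_iff_im.1 (congrFun hχ g)
    exact star_star z
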